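/- Write $0_\circ=-\infty$, $1_\circ=0$, $\mathbb{R}_{\max}=\mathbb{R}\cup\{-\infty\}$, $a\oplus b=\max\{a,b\}$, $a\odot b=a+b$, $a\oslash b=a-b$. A tropical meromorphic function is a continuous piecewise linear function $f:\mathbb{R}\to\mathbb{R}$ (arbitrary real slopes, break points without finite limit point). Put $\omega_f(x)=\lim_{\epsilon\to0+}(f'(x+\epsilon)-f'(x-\epsilon))$; points with $\omega_f>0$ are roots, points with $\omega_f<0$ are poles, with multiplicity $|\omega_f(x)|$; $f$ is tropical entire if it has no poles. Let $n(t,f)=\sum_{|s|\le t,\ \omega_f(s)<0}|\omega_f(s)|$ and $N(r,f)=\frac12\int_0^r n(t,f)\,dt$. Let $n,q$ be positive integers with $q>n$, let $\varepsilon>0$, and fix $c\in\mathbb{R}\setminus\{0\}$. Let $g_0,\dots,g_n$ be tropical entire functions with no root common to all of them (so that $\mathbf g=(g_0,\dots,g_n)$ is a reduced representation of the tropical holomorphic curve $g=[g_0:\cdots:g_n]:\mathbb{R}\to\mathbb{TP}^n$) which are linearly independent in the Gondran–Minoux sense: there are no disjoint $I,J$ with $I\cup J=\{0,\dots,n\}$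 and $\alpha_0,\dots,\alpha_n\in\mathbb{R}_{\max}$, not all $0_\circ$, such that $\bigoplus_{i\in I}\alpha_i\odot g_i=\bigoplus_{j\in J}\alpha_j\odot g_j$ on $\mathbb{R}$ (an empty sum being $0_\circ$). Let $$T_g(r)=\tfrac12\bigl(F(r)+F(-r)\bigr)-F(0),\qquad F(x)=\max_{0\le j\le n} g_j(x),$$ and suppose that the hyper-order $\varsigma=\limsup_{r\to\infty}\frac{\log\log T_g(r)}{\log r}$ satisfies $\varsigma<1$. For $0\le k\le q$ let $f_k=\bigoplus_{j=0}^n a_{jk}\odot g_j$ with $a_{jk}\in\mathbb{R}_{\max}$ and $f_k\not\equiv0_\circ$. For $f\not\equiv 0_\circ$ in the tropical span of the $g_j$ let $\ell(f)$ be the least number of terms in a representation $f=\bigoplus_{k\in K}b_k\odot g_k$ with $K\subseteq\{0,\dots,n\}$ and real $b_k$, and let $\lambda$ be the degree of degeneracy of $f_{n+1},\dots,f_q$, that is, the number of indices $\nu\in\{n+1,\dots,q\}$ with $\ell(f_\nu)<n+1$. Put $$C_\circ(f_0,\dots,f_n)(x)=\max_{\pi}\sum_{i=0}^n f_i\bigl(x+\pi(i)c\bigr),\qquad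 L=(f_0\odot\cdots\odot f_q)\oslash C_\circ(f_0,\dots,f_n),$$ where $\pi$ runs over all permutations of $\{0,\dots,n\}$. Then $$(q-n-\lambda)\,T_g(r)\le N(r,1_\circ\oslash L)-N(r,L)+o\!\left(\frac{T_g(r)}{r^{1-\varsigma-\varepsilon}}\right)$$ as $r\to\infty$ outside a set $E\subset[1,\infty)$ of finite logarithmic measure, i.e. with $\int_E dr/r<\infty$. -/

import Mathlib

open Filter Topology Asymptotics MeasureTheory

/-- The max-plus semiring `ℝ ∪ {-∞}`: tropical addition is `max`, tropical multiplication is `+`,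
the tropical zero is `⊥ = -∞` and the tropical unit is `0`. -/
abbrev RMax : Type := WithBot ℝ

/-- Real continuous piecewise linear functions on `ℝ` with arbitrary real slopes: to the left and to
the right of each point the function is affine for a while. (By compactness this says that the
function is continuous and affine off a set of break points without finite limit points.) -/
def IsTropicalMeromorphic (f : ℝ → ℝ) : Prop :=
  Continuous f ∧ ∀ x : ℝ, ∃ a b : ℝ,
    (∀ᶠ y in 𝓝[<] x, f y = f x + a * (y - x)) ∧ (∀ᶠ y in 𝓝[>] x, f y = f x + b * (y - x))

/-- `ω_f(x) = lim_{ε → 0+} (f'(x + ε) - f'(x - ε))`. A point with `ω_f(x) > 0` is a root of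
multiplicity `ω_f(x)`, a point with `ω_f(x) < 0` is a pole of multiplicity `|ω_f(x)|`. -/
noncomputable def tropicalOmega (f : ℝ → ℝ) (x : ℝ) : ℝ :=
  limUnder (𝓝[>] (0 : ℝ)) (fun ε : ℝ => deriv f (x + ε) - deriv f (x - ε))

/-- `x` is a root of `f`. -/
def IsTropicalRoot (f : ℝ → ℝ) (x : ℝ) : Prop := 0 < tropicalOmega f x

/-- `x` is a pole of `f`. -/
def IsTropicalPole (f : ℝ → ℝ) (x : ℝ) : Prop := tropicalOmega f x < 0

/-- Tropical entire functions: tropical meromorphic functions without poles. -/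
def IsTropicalEntire (f : ℝ → ℝ) : Prop :=
  IsTropicalMeromorphic f ∧ ∀ x : ℝ, ¬ IsTropicalPole f x

/-- `n(t, f)`: the number of poles of `f` in `[-t, t]`, counted with multiplicity. -/
noncomputable def tropicalPoleCount (f : ℝ → ℝ) (t : ℝ) : ℝ :=
  ∑ᶠ (s : ℝ) (_ : |s| ≤ t ∧ IsTropicalPole f s), |tropicalOmega f s|

/-- The tropical counting function `N(r, f) = (1/2) ∫_0^r n(t, f) dt`. -/
noncomputable def tropicalCounting (f : ℝ → ℝ) (r : ℝ) : ℝ :=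
  (1 / 2) * ∫ t in (0 : ℝ)..r, tropicalPoleCount f t

/-- The tropical linear combination `⨁_{k ∈ K} a_k ⊙ g_k` over an index set `K`, a function with
values in the max-plus semiring. The empty combination is the tropical zero. -/
noncomputable def tropicalLinComb {n : ℕ} (K : Finset (Fin (n + 1))) (a : Fin (n + 1) → RMax)
    (g : Fin (n + 1) → ℝ → ℝ) (x : ℝ) : RMax :=
  K.sup (fun k => a k + ((g k x : ℝ) : RMax))

/-- Linear dependence in the Gondran–Minoux sense. -/
def GondranMinouxDependent {n : ℕ} (g : Fin (n + 1) → ℝ → ℝ) : Prop :=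
  ∃ I J : Finset (Fin (n + 1)), Disjoint I J ∧ I ∪ J = Finset.univ ∧
    ∃ α : Fin (n + 1) → RMax, (∃ i, α i ≠ ⊥) ∧
      ∀ x : ℝ, tropicalLinComb I α g x = tropicalLinComb J α g x

/-- Linear independence in the Gondran–Minoux sense. -/
def GondranMinouxIndependent {n : ℕ} (g : Fin (n + 1) → ℝ → ℝ) : Prop :=
  ¬ GondranMinouxDependent g

/-- `ℓ(f)`: the least number of terms in a representation of `f` as a tropical linear combination
of the `g_k` with real coefficients. A nonzero element of the span of the `g_k` is real valued, so
`f` is taken real valued. -/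
noncomputable def tropicalShortestLength {n : ℕ} (g : Fin (n + 1) → ℝ → ℝ) (f : ℝ → ℝ) : ℕ :=
  sInf {m : ℕ | ∃ (K : Finset (Fin (n + 1))) (b : Fin (n + 1) → ℝ), K.card = m ∧
    ∀ x : ℝ, ((f x : ℝ) : RMax) = tropicalLinComb K (fun k => ((b k : ℝ) : RMax)) g x}

/-- The degree of degeneracy of a family of tropical linear combinations of `g_0, …, g_n`:
the number of its non-complete members, i.e. those with `ℓ(f) < n + 1`. -/
noncomputable def degreeOfDegeneracy {n : ℕ} {ι : Type*} (g : Fin (n + 1) → ℝ → ℝ)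
    (Q : ι → ℝ → ℝ) : ℕ :=
  Set.ncard {ν : ι | tropicalShortestLength g (Q ν) < n + 1}

/-- `(g_0, …, g_n)` is a reduced representation of a tropical holomorphic curve
`[g_0 : ⋯ : g_n] : ℝ → TPⁿ`: the `g_j` are tropical entire and have no root common to all. -/
def IsReducedRepresentation {n : ℕ} (g : Fin (n + 1) → ℝ → ℝ) : Prop :=
  (∀ j, IsTropicalEntire (g j)) ∧ ¬ ∃ x : ℝ, ∀ j, IsTropicalRoot (g j) x

/-- `F(x) = max {g_0(x), …, g_n(x)}`. -/
noncomputable def componentMax {n : ℕ} (g : Fin (n + 1) → ℝ → ℝ) (x : ℝ) : ℝ :=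
  Finset.univ.sup' Finset.univ_nonempty (fun j => g j x)

/-- The tropical Cartan characteristic `T_g(r) = (F(r) + F(-r)) / 2 - F(0)`. -/
noncomputable def cartanCharacteristic {n : ℕ} (g : Fin (n + 1) → ℝ → ℝ) (r : ℝ) : ℝ :=
  (1 / 2) * (componentMax g r + componentMax g (-r)) - componentMax g 0

/-- The hyper-order `limsup_{r → ∞} log log T_g(r) / log r`. -/
noncomputable def cartanHyperOrder {n : ℕ} (g : Fin (n + 1) → ℝ → ℝ) : EReal :=
  limsup (fun r : ℝ =>
    ((Real.log (Real.log (cartanCharacteristic g r)) / Real.log r : ℝ) : EReal)) atTop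

/-- The tropical Casoratian with step `c`: the tropical determinant
`⨁_π f_0(x + π(0) c) ⊙ ⋯ ⊙ f_n(x + π(n) c)` over all permutations `π` of `{0, …, n}`. -/
noncomputable def tropicalCasoratian {n : ℕ} (c : ℝ) (f : Fin (n + 1) → ℝ → ℝ) (x : ℝ) : ℝ :=
  Finset.univ.sup' Finset.univ_nonempty
    (fun π : Equiv.Perm (Fin (n + 1)) => ∑ i, f i (x + ((π i : ℕ) : ℝ) * c))

/-- The function `L = f_0 ⊙ ⋯ ⊙ f_q ⊘ C_∘(f_0, …, f_n)`. -/
noncomputable def cartanQuotient {n q : ℕ} (hnq : n < q) (c : ℝ) (f : Fin (q + 1) → ℝ → ℝ)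
    (x : ℝ) : ℝ :=
  (∑ k, f k x) -
    tropicalCasoratian c (fun i : Fin (n + 1) => f (Fin.castLE (Nat.succ_le_succ hnq.le) i)) x

/-- `E ⊆ [1, ∞)` is a measurable set of finite logarithmic measure: `∫_E dr / r < ∞`. -/
def HasFiniteLogMeasure (E : Set ℝ) : Prop :=
  E ⊆ Set.Ici 1 ∧ MeasurableSet E ∧ ∫⁻ r in E, ENNReal.ofReal (1 / r) < ⊤

/-! The tropical Jensen formula turns `N(r, 1/L) - N(r, L)` into `(L(r) + L(-r))/2 - L(0)`, so
everything reduces to a lower bound for `L` at `±r`. There `L` is the sum of the `f_ν` with `ν > n`,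
minus the excess of the Casoratian over `f_0 + ⋯ + f_n`. A complete `f_ν` involves every `g_j`,
hence stays within a constant below `F` and contributes `T_g(r)`; any other `f_ν` is convex, so its
mean at `±r` is at least `f_ν(0)`. This yields `(q - n - λ) T_g(r)` up to a constant
(`exists_le_sum_of_degreeOfDegeneracy`).

The excess is a tropical logarithmic difference estimate. Entire functions are convex, so an
increment over a bounded step is controlled by the mean slope over a much longer step `r ^ δ`,
giving `O(T_g(r + r ^ δ) / r ^ δ)` (`ConvexOn.exists_shift_le`). Hyper-order below one means `log
T_g(r) ≤ r ^ β` eventually, and the Borel type lemma `hasFiniteLogMeasure_growth` then gives `T_g(r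
+ r ^ δ) ≤ e T_g(r)` outside a set of finite logarithmic measure when `β + δ < 1`. Constants are
absorbed because independence forces `T_g` to grow at least linearly. -/

/-! ### One-sided slopes, and passing from local slopes to chords. -/

/-- `f` is affine with slope `a` immediately to the left of `x` and affine with slope `b`
immediately to the right of `x`. -/
def HasOneSidedSlopes (f : ℝ → ℝ) (x a b : ℝ) : Prop :=
  (∀ᶠ y in 𝓝[<] x, f y = f x + a * (y - x)) ∧ (∀ᶠ y in 𝓝[>] x, f y = f x + b * (y - x))

namespace HasOneSidedSlopes

variable {f g : ℝ → ℝ} {x a b a' b' : ℝ}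

theorem eventually_nhds (h : HasOneSidedSlopes f x a a) :
    ∀ᶠ y in 𝓝 x, f y = f x + a * (y - x) := by
  have h1 : ∀ᶠ y in 𝓝[≠] x, f y = f x + a * (y - x) := by
    rw [← nhdsLT_sup_nhdsGT, eventually_sup]
    exact h
  rw [eventually_nhdsWithin_iff] at h1
  filter_upwards [h1] with y hy
  rcases eq_or_ne y x with rfl | hne
  · simp
  · exact hy hne

theorem hasDerivAt (h : HasOneSidedSlopes f x a a) : HasDerivAt f a x := by
  have h1 : HasDerivAt (fun y => f x + a * (y - x)) a x := by
    simpa using (((hasDerivAt_id x).sub_const x).const_mul a).const_add (f x)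
  exact h1.congr_of_eventuallyEq h.eventually_nhds

theorem eventually_right (h : HasOneSidedSlopes f x a b) :
    ∀ᶠ y in 𝓝[>] x, HasOneSidedSlopes f y b b := by
  have h1 := eventually_eventually_nhdsWithin.2 h.2
  filter_upwards [h1, h.2, self_mem_nhdsWithin] with y hy hy2 hyx
  rw [isOpen_Ioi.nhdsWithin_eq hyx] at hy
  have h2 : ∀ᶠ z in 𝓝 y, f z = f y + b * (z - y) := by
    filter_upwards [hy] with z hz
    rw [hz, hy2]; ring
  exact ⟨h2.filter_mono nhdsWithin_le_nhds, h2.filter_mono nhdsWithin_le_nhds⟩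

theorem eventually_left (h : HasOneSidedSlopes f x a b) :
    ∀ᶠ y in 𝓝[<] x, HasOneSidedSlopes f y a a := by
  have h1 := eventually_eventually_nhdsWithin.2 h.1
  filter_upwards [h1, h.1, self_mem_nhdsWithin] with y hy hy2 hyx
  rw [isOpen_Iio.nhdsWithin_eq hyx] at hy
  have h2 : ∀ᶠ z in 𝓝 y, f z = f y + a * (z - y) := by
    filter_upwards [hy] with z hz
    rw [hz, hy2]; ring
  exact ⟨h2.filter_mono nhdsWithin_le_nhds, h2.filter_mono nhdsWithin_le_nhds⟩

theorem tropicalOmega_eq (h : HasOneSidedSlopes f x a b) : tropicalOmega f x = b - a := by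
  apply Tendsto.limUnder_eq
  apply tendsto_const_nhds.congr'
  have hr : Tendsto (fun ε : ℝ => x + ε) (𝓝[>] 0) (𝓝[>] x) := by
    apply tendsto_nhdsWithin_of_tendsto_nhds_of_eventually_within
    · have : Tendsto (fun ε : ℝ => x + ε) (𝓝 0) (𝓝 (x + 0)) :=
        (by fun_prop : Continuous fun ε : ℝ => x + ε).tendsto 0
      rw [add_zero] at this
      exact this.mono_left nhdsWithin_le_nhds
    · filter_upwards [self_mem_nhdsWithin] with ε hε
      simpa using hε
  have hl : Tendsto (fun ε : ℝ => x - ε) (𝓝[>] 0) (𝓝[<] x) := by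
    apply tendsto_nhdsWithin_of_tendsto_nhds_of_eventually_within
    · have : Tendsto (fun ε : ℝ => x - ε) (𝓝 0) (𝓝 (x - 0)) :=
        (by fun_prop : Continuous fun ε : ℝ => x - ε).tendsto 0
      rw [sub_zero] at this
      exact this.mono_left nhdsWithin_le_nhds
    · filter_upwards [self_mem_nhdsWithin] with ε hε
      simpa using hε
  filter_upwards [hr.eventually h.eventually_right, hl.eventually h.eventually_left] with ε h1 h2
  rw [h1.hasDerivAt.deriv, h2.hasDerivAt.deriv]

theorem congr (h : HasOneSidedSlopes f x a b) (hfg : g =ᶠ[𝓝 x] f) :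
    HasOneSidedSlopes g x a b := by
  have hx := hfg.self_of_nhds
  constructor
  · filter_upwards [h.1, hfg.filter_mono nhdsWithin_le_nhds] with y h1 h2
    rw [h2, h1, hx]
  · filter_upwards [h.2, hfg.filter_mono nhdsWithin_le_nhds] with y h1 h2
    rw [h2, h1, hx]

theorem neg (h : HasOneSidedSlopes f x a b) :
    HasOneSidedSlopes (fun y => -f y) x (-a) (-b) := by
  constructor
  · filter_upwards [h.1] with y h1
    rw [h1]; ring
  · filter_upwards [h.2] with y h1
    rw [h1]; ring

theorem add (h : HasOneSidedSlopes f x a b) (h' : HasOneSidedSlopes g x a' b') :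
    HasOneSidedSlopes (fun y => f y + g y) x (a + a') (b + b') := by
  constructor
  · filter_upwards [h.1, h'.1] with y h1 h2
    rw [h1, h2]; ring
  · filter_upwards [h.2, h'.2] with y h1 h2
    rw [h1, h2]; ring

theorem const_mul (h : HasOneSidedSlopes f x a b) (k : ℝ) :
    HasOneSidedSlopes (fun y => k * f y) x (k * a) (k * b) := by
  constructor
  · filter_upwards [h.1] with y h1
    rw [h1]; ring
  · filter_upwards [h.2] with y h1
    rw [h1]; ring

theorem comp_add_const (k : ℝ) (h : HasOneSidedSlopes f (x + k) a b) :
    HasOneSidedSlopes (fun y => f (y + k)) x a b := by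
  have ht : Tendsto (fun y : ℝ => y + k) (𝓝 x) (𝓝 (x + k)) := by
    have : Continuous fun y : ℝ => y + k := by fun_prop
    exact this.tendsto x
  constructor
  · have : Tendsto (fun y : ℝ => y + k) (𝓝[<] x) (𝓝[<] (x + k)) := by
      apply tendsto_nhdsWithin_of_tendsto_nhds_of_eventually_within _
        (ht.mono_left nhdsWithin_le_nhds)
      filter_upwards [self_mem_nhdsWithin] with y hy
      simpa using hy
    filter_upwards [this.eventually h.1] with y h1
    rw [h1]; ring
  · have : Tendsto (fun y : ℝ => y + k) (𝓝[>] x) (𝓝[>] (x + k)) := by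
      apply tendsto_nhdsWithin_of_tendsto_nhds_of_eventually_within _
        (ht.mono_left nhdsWithin_le_nhds)
      filter_upwards [self_mem_nhdsWithin] with y hy
      simpa using hy
    filter_upwards [this.eventually h.2] with y h1
    rw [h1]; ring

/-- To the left of `x` the increment `y - x` is negative, so the larger branch is the one with the
smaller slope. -/
theorem max_of_eq (h : HasOneSidedSlopes f x a b) (h' : HasOneSidedSlopes g x a' b')
    (hx : f x = g x) :
    HasOneSidedSlopes (fun y => max (f y) (g y)) x (min a a') (max b b') := by
  constructor
  · filter_upwards [h.1, h'.1, self_mem_nhdsWithin] with y h1 h2 h3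
    have h3 : y - x ≤ 0 := (sub_neg.2 h3).le
    rw [h1, h2, hx, max_self, max_add_add_left]
    congr 1
    rcases le_total a a' with h | h
    · rw [min_eq_left h, max_eq_left (mul_le_mul_of_nonpos_right h h3)]
    · rw [min_eq_right h, max_eq_right (mul_le_mul_of_nonpos_right h h3)]
  · filter_upwards [h.2, h'.2, self_mem_nhdsWithin] with y h1 h2 h3
    have h3 : 0 ≤ y - x := (sub_pos.2 h3).le
    rw [h1, h2, hx, max_self, max_add_add_left, max_mul_of_nonneg _ _ h3]

theorem posPart_sub (x s : ℝ) :
    HasOneSidedSlopes (fun y => max (y - s) 0) x (if s < x then 1 else 0)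
      (if s ≤ x then 1 else 0) := by
  rcases lt_trichotomy s x with h | rfl | h
  · have : ∀ᶠ y in 𝓝 x, max (y - s) 0 = max (x - s) 0 + 1 * (y - x) := by
      filter_upwards [eventually_gt_nhds h] with y hy
      rw [max_eq_left (by linarith), max_eq_left (by linarith)]; ring
    simp only [h, h.le, if_true]
    exact ⟨this.filter_mono nhdsWithin_le_nhds, this.filter_mono nhdsWithin_le_nhds⟩
  · constructor
    · filter_upwards [self_mem_nhdsWithin] with y hy
      have hy : y < s := hy
      rw [max_eq_right (by linarith)]; simp
    · filter_upwards [self_mem_nhdsWithin] with y hy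
      have hy : s < y := hy
      rw [max_eq_left (by linarith)]; simp
  · have : ∀ᶠ y in 𝓝 x, max (y - s) 0 = max (x - s) 0 + 0 * (y - x) := by
      filter_upwards [eventually_lt_nhds h] with y hy
      rw [max_eq_right (by linarith), max_eq_right (by linarith)]; ring
    simp only [h.not_ge, h.not_gt, if_false]
    exact ⟨this.filter_mono nhdsWithin_le_nhds, this.filter_mono nhdsWithin_le_nhds⟩

theorem sum {ι : Type*} (S : Finset ι) {F : ι → ℝ → ℝ} {A B : ι → ℝ}
    (h : ∀ i ∈ S, HasOneSidedSlopes (F i) x (A i) (B i)) :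
    HasOneSidedSlopes (fun y => ∑ i ∈ S, F i y) x (∑ i ∈ S, A i) (∑ i ∈ S, B i) := by
  have h1 := (S.eventually_all (l := 𝓝[<] x)
    (p := fun i y => F i y = F i x + A i * (y - x))).2 fun i hi => (h i hi).1
  have h2 := (S.eventually_all (l := 𝓝[>] x)
    (p := fun i y => F i y = F i x + B i * (y - x))).2 fun i hi => (h i hi).2
  constructor
  · filter_upwards [h1] with y hy
    rw [Finset.sum_congr rfl hy, Finset.sum_add_distrib, Finset.sum_mul]
  · filter_upwards [h2] with y hy
    rw [Finset.sum_congr rfl hy, Finset.sum_add_distrib, Finset.sum_mul]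

end HasOneSidedSlopes

/-- A continuous function on an interval, affine on both sides of every interior point with slopes
that do not decrease, lies below its chord. -/
theorem midpoint_le_of_slopes {f : ℝ → ℝ} (hf : Continuous f) {x y z : ℝ} (hxz : x < z)
    (hzy : z < y)
    (h : ∀ p ∈ Set.Ioo x y, ∃ a b, a ≤ b ∧ HasOneSidedSlopes f p a b) :
    (y - x) * f z ≤ (y - z) * f x + (z - x) * f y := by
  by_contra! hlt
  have hyx : 0 < y - x := by linarith
  set m := (f y - f x) / (y - x) with hm
  have hm' : m * (y - x) = f y - f x := by rw [hm]; field_simp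
  -- Maximum principle: subtracting the chord's slope equalises the end values, so the violation at
  -- `z` forces an interior maximum. Let `p` be the rightmost maximum point: the left slope there is
  -- nonnegative, hence so is the right one, and the maximum persists to the right of `p`.
  let u : ℝ → ℝ := fun w => f w + -(m * (w - x))
  have hu : Continuous u := by fun_prop
  have hux : u x = f x := by simp [u]
  have huy : u y = f x := by simp only [u]; linarith
  have huz : f x < u z := by
    have : 0 < (y - x) * (u z - f x) := by
      have : (y - x) * (u z - f x) = (y - x) * f z - ((y - z) * f x + (z - x) * f y) := by
        simp only [u]; linear_combination (x - z) * hm'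
      linarith
    nlinarith [(mul_pos_iff_of_pos_left hyx).1 this]
  obtain ⟨p₀, hp₀, hmax⟩ := isCompact_Icc.exists_isMaxOn (s := Set.Icc x y)
    ⟨z, hxz.le, hzy.le⟩ hu.continuousOn
  have hK : IsCompact (Set.Icc x y ∩ u ⁻¹' {u p₀}) :=
    isCompact_Icc.inter_right (isClosed_singleton.preimage hu)
  obtain ⟨p, ⟨hpI, hpu⟩, hpmax⟩ := hK.exists_isMaxOn ⟨p₀, hp₀, rfl⟩ continuousOn_id
  have hpu : u p = u p₀ := hpu
  have hbig : f x < u p := by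
    rw [hpu]; exact huz.trans_le (hmax ⟨hxz.le, hzy.le⟩)
  have hpx : x < p := lt_of_le_of_ne hpI.1 (by rintro rfl; linarith)
  have hpy : p < y := lt_of_le_of_ne hpI.2 (by rintro rfl; linarith)
  obtain ⟨a, b, hab, hs⟩ := h p ⟨hpx, hpy⟩
  have hL : ∀ᶠ w in 𝓝[<] p, 0 ≤ a - m := by
    filter_upwards [hs.1, self_mem_nhdsWithin,
      (eventually_gt_nhds hpx).filter_mono nhdsWithin_le_nhds] with w h1 h2 h3
    have h2 : w < p := h2
    have h4 : u w ≤ u p := by rw [hpu]; exact hmax ⟨h3.le, by linarith⟩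
    have h5 : u w = u p + (a - m) * (w - p) := by simp only [u, h1]; ring
    by_contra! h6
    nlinarith
  have ha : 0 ≤ a - m := hL.exists.choose_spec
  have hR : ∀ᶠ w in 𝓝[>] p, False := by
    filter_upwards [hs.2, self_mem_nhdsWithin,
      (eventually_lt_nhds hpy).filter_mono nhdsWithin_le_nhds] with w h1 h2 h3
    have h2 : p < w := h2
    have h4 : u w ≤ u p := by rw [hpu]; exact hmax ⟨by linarith, h3.le⟩
    have h5 : u w = u p + (b - m) * (w - p) := by simp only [u, h1]; ring
    have h6 : 0 ≤ (b - m) * (w - p) := mul_nonneg (by linarith) (by linarith)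
    have h7 : u w = u p₀ := by linarith
    have h8 : w ≤ p := hpmax (show w ∈ Set.Icc x y ∩ u ⁻¹' {u p₀} from
      ⟨⟨by linarith, h3.le⟩, h7⟩)
    linarith
  exact hR.exists.choose_spec

/-! ### Tropical meromorphic functions. -/

namespace IsTropicalMeromorphic

variable {f g : ℝ → ℝ}

theorem exists_slopes (hf : IsTropicalMeromorphic f) (x : ℝ) :
    ∃ a b, HasOneSidedSlopes f x a b ∧ tropicalOmega f x = b - a := by
  obtain ⟨a, b, h⟩ := hf.2 x
  exact ⟨a, b, h, HasOneSidedSlopes.tropicalOmega_eq h⟩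

theorem neg (hf : IsTropicalMeromorphic f) : IsTropicalMeromorphic (fun x => -f x) := by
  refine ⟨hf.1.neg, fun x => ?_⟩
  obtain ⟨a, b, h, -⟩ := hf.exists_slopes x
  exact ⟨_, _, h.neg⟩

theorem add (hf : IsTropicalMeromorphic f) (hg : IsTropicalMeromorphic g) :
    IsTropicalMeromorphic (fun x => f x + g x) := by
  refine ⟨hf.1.add hg.1, fun x => ?_⟩
  obtain ⟨a, b, h, -⟩ := hf.exists_slopes x
  obtain ⟨a', b', h', -⟩ := hg.exists_slopes x
  exact ⟨_, _, h.add h'⟩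

theorem sub (hf : IsTropicalMeromorphic f) (hg : IsTropicalMeromorphic g) :
    IsTropicalMeromorphic (fun x => f x - g x) := by
  simpa only [sub_eq_add_neg] using hf.add hg.neg

theorem const (k : ℝ) : IsTropicalMeromorphic (fun _ => k) :=
  ⟨continuous_const, fun _ => ⟨0, 0, by simp, by simp⟩⟩

theorem sum {ι : Type*} (S : Finset ι) {F : ι → ℝ → ℝ}
    (h : ∀ i ∈ S, IsTropicalMeromorphic (F i)) :
    IsTropicalMeromorphic (fun x => ∑ i ∈ S, F i x) := by
  classical
  induction S using Finset.induction_on with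
  | empty => simpa using const 0
  | insert i S hi ih =>
    simp only [Finset.sum_insert hi]
    exact (h i (by simp)).add (ih fun j hj => h j (by simp [hj]))

theorem comp_add_const (hf : IsTropicalMeromorphic f) (k : ℝ) :
    IsTropicalMeromorphic (fun x => f (x + k)) := by
  refine ⟨hf.1.comp (by fun_prop), fun x => ?_⟩
  obtain ⟨a, b, h, -⟩ := hf.exists_slopes (x + k)
  exact ⟨_, _, h.comp_add_const⟩

theorem max (hf : IsTropicalMeromorphic f) (hg : IsTropicalMeromorphic g) :
    IsTropicalMeromorphic (f ⊔ g) := by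
  refine ⟨hf.1.sup hg.1, fun x => ?_⟩
  obtain ⟨a, b, h, -⟩ := hf.exists_slopes x
  obtain ⟨a', b', h', -⟩ := hg.exists_slopes x
  rcases lt_trichotomy (f x) (g x) with hlt | heq | hlt
  · refine ⟨_, _, h'.congr (g := f ⊔ g) ?_⟩
    filter_upwards [hf.1.continuousAt.eventually_lt hg.1.continuousAt hlt] with y hy
    exact sup_eq_right.2 hy.le
  · exact ⟨_, _, h.max_of_eq h' heq⟩
  · refine ⟨_, _, h.congr (g := f ⊔ g) ?_⟩
    filter_upwards [hg.1.continuousAt.eventually_lt hf.1.continuousAt hlt] with y hy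
    exact sup_eq_left.2 hy.le

theorem sup' {ι : Type*} {S : Finset ι} (hS : S.Nonempty) {F : ι → ℝ → ℝ}
    (h : ∀ i ∈ S, IsTropicalMeromorphic (F i)) :
    IsTropicalMeromorphic (fun x => S.sup' hS fun i => F i x) := by
  have := Finset.sup'_induction hS F (p := IsTropicalMeromorphic)
    (fun _ h1 _ h2 => h1.max h2) h
  convert this using 1
  ext x
  rw [Finset.sup'_apply]

/-- Each point has a neighbourhood containing no other break point; compactness does the rest. -/
theorem finite_omega_ne_zero (hf : IsTropicalMeromorphic f) {K : Set ℝ} (hK : IsCompact K) :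
    ({x | tropicalOmega f x ≠ 0} ∩ K).Finite := by
  refine hK.induction_on (p := fun s => ({x | tropicalOmega f x ≠ 0} ∩ s).Finite) (by simp)
    (fun s t hst ht => ht.subset (Set.inter_subset_inter_right _ hst))
    (fun s t hs ht => by rw [Set.inter_union_distrib_left]; exact hs.union ht) fun x _ => ?_
  obtain ⟨a, b, h, -⟩ := hf.exists_slopes x
  have h0 : ∀ᶠ y in 𝓝[≠] x, tropicalOmega f y = 0 := by
    rw [← nhdsLT_sup_nhdsGT, eventually_sup]
    constructor
    · filter_upwards [h.eventually_left] with y hy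
      rw [hy.tropicalOmega_eq, sub_self]
    · filter_upwards [h.eventually_right] with y hy
      rw [hy.tropicalOmega_eq, sub_self]
  rw [eventually_nhdsWithin_iff] at h0
  refine ⟨_, nhdsWithin_le_nhds h0, (Set.finite_singleton x).subset ?_⟩
  rintro y ⟨hy1, hy2⟩
  by_contra hne
  exact hy1 (hy2 hne)

theorem tropicalOmega_neg (hf : IsTropicalMeromorphic f) (x : ℝ) :
    tropicalOmega (fun y => -f y) x = -tropicalOmega f x := by
  obtain ⟨a, b, h, hω⟩ := hf.exists_slopes x
  rw [hω, h.neg.tropicalOmega_eq]; ring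

end IsTropicalMeromorphic

/-! ### The counting function, Jensen's formula and convexity. -/

/-- A pole `s` is counted for `t` in `[|s|, r]`, an interval of length `r - |s|`. The set `S` may
contain points that are not poles, so one set of break points serves both `f` and `-f`. -/
theorem tropicalCounting_eq_sum {f : ℝ → ℝ} {r : ℝ} (hr : 0 ≤ r) (S : Finset ℝ)
    (hS : ∀ x, |x| ≤ r → tropicalOmega f x ≠ 0 → x ∈ S) (hS' : ∀ x ∈ S, |x| ≤ r) :
    tropicalCounting f r = (1 / 2) * ∑ s ∈ S, max (-tropicalOmega f s) 0 * (r - |s|) := by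
  classical
  unfold tropicalCounting
  congr 1
  have h1 : ∀ t ∈ Set.uIcc 0 r, tropicalPoleCount f t =
      ∑ s ∈ S, (Set.Ici |s|).indicator (fun _ => max (-tropicalOmega f s) 0) t := by
    intro t ht
    rw [Set.uIcc_of_le hr] at ht
    unfold tropicalPoleCount
    rw [finsum_eq_sum_of_support_subset (s := S)]
    · refine Finset.sum_congr rfl fun s _ => ?_
      by_cases hst : |s| ≤ t
      · rw [Set.indicator_of_mem (show t ∈ Set.Ici |s| from hst)]
        by_cases hp : tropicalOmega f s < 0
        · rw [finsum_eq_if, if_pos ⟨hst, hp⟩, abs_of_neg hp, max_eq_left (by linarith)]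
        · rw [finsum_eq_if, if_neg fun h => hp h.2, max_eq_right (by linarith)]
      · rw [Set.indicator_of_notMem (show t ∉ Set.Ici |s| from hst), finsum_eq_if,
          if_neg fun h => hst h.1]
    · intro s hs
      rw [Function.mem_support, finsum_eq_if] at hs
      split_ifs at hs with h
      · exact hS s (h.1.trans ht.2) h.2.ne
      · exact absurd rfl hs
  rw [intervalIntegral.integral_congr h1, intervalIntegral.integral_finsetSum]
  · refine Finset.sum_congr rfl fun s hs => ?_
    have hs' := hS' s hs
    rw [intervalIntegral.integral_of_le hr, MeasureTheory.integral_indicator measurableSet_Ici,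
      MeasureTheory.setIntegral_const, smul_eq_mul, mul_comm]
    congr 1
    rw [Measure.real, Measure.restrict_apply measurableSet_Ici]
    -- The two sets can differ only at `t = 0`, when `s = 0`.
    have : (volume : Measure ℝ) (Set.Ici |s| ∩ Set.Ioc 0 r) = volume (Set.Icc |s| r) := by
      apply measure_congr
      have h0 : ∀ᵐ t : ℝ, t ≠ 0 := by simp [ae_iff]
      filter_upwards [h0] with t ht
      apply propext
      constructor
      · rintro ⟨h1, h2⟩
        exact ⟨h1, h2.2⟩
      · rintro ⟨h1, h2⟩
        exact ⟨h1, lt_of_le_of_ne ((abs_nonneg s).trans h1) ht.symm, h2⟩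
    rw [this, Real.volume_Icc, ENNReal.toReal_ofReal (by linarith)]
  · intro s _
    rw [intervalIntegrable_iff_integrableOn_Ioc_of_le hr]
    exact (integrable_const _).indicator measurableSet_Ici

/-- The tropical Jensen formula. -/
theorem tropical_jensen {f : ℝ → ℝ} (hf : IsTropicalMeromorphic f) {r : ℝ} (hr : 0 < r) :
    tropicalCounting (fun x => 0 - f x) r - tropicalCounting f r =
      (1 / 2) * (f r + f (-r)) - f 0 := by
  have hfin := hf.finite_omega_ne_zero (isCompact_Icc (a := -r) (b := r))
  set S := hfin.toFinset with hSdef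
  have hmem : ∀ x, x ∈ S ↔ tropicalOmega f x ≠ 0 ∧ |x| ≤ r := by
    intro x
    simp [hSdef, abs_le]
  have hω : ∀ s, tropicalOmega (fun x => 0 - f x) s = -tropicalOmega f s := by
    intro s
    simpa using hf.tropicalOmega_neg s
  rw [tropicalCounting_eq_sum hr.le S (fun x h1 h2 => (hmem x).2 ⟨by rwa [hω, neg_ne_zero] at h2, h1⟩)
      (fun x hx => ((hmem x).1 hx).2),
    tropicalCounting_eq_sum hr.le S (fun x h1 h2 => (hmem x).2 ⟨h2, h1⟩)
      (fun x hx => ((hmem x).1 hx).2), ← mul_sub, ← Finset.sum_sub_distrib]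
  have hsum : ∑ s ∈ S, (max (-tropicalOmega (fun x => 0 - f x) s) 0 * (r - |s|) -
      max (-tropicalOmega f s) 0 * (r - |s|)) = ∑ s ∈ S, tropicalOmega f s * (r - |s|) := by
    refine Finset.sum_congr rfl fun s _ => ?_
    rw [hω, neg_neg, ← sub_mul]
    congr 1
    rcases le_total 0 (tropicalOmega f s) with h | h
    · rw [max_eq_left h, max_eq_right (by linarith)]; ring
    · rw [max_eq_right h, max_eq_left (by linarith)]; ring
  rw [hsum]
  -- One hinge per break point removes every jump of slope inside `(-r, r)`. So `G` and `-G` both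
  -- satisfy the chord inequality, and `G(0)` is the mean of `G(±r)`.
  let G : ℝ → ℝ := fun x => f x + ∑ s ∈ S, -tropicalOmega f s * max (x - s) 0
  have hG : Continuous G := by
    have := hf.1
    fun_prop
  have hGs : ∀ p ∈ Set.Ioo (-r) r, ∃ a, HasOneSidedSlopes G p a a := by
    intro p hp
    obtain ⟨a, b, h, hab⟩ := hf.exists_slopes p
    have h1 := h.add (HasOneSidedSlopes.sum S fun s _ =>
      (HasOneSidedSlopes.posPart_sub p s).const_mul (-tropicalOmega f s))
    have h2 : b + ∑ s ∈ S, -tropicalOmega f s * (if s ≤ p then 1 else 0) =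
        a + ∑ s ∈ S, -tropicalOmega f s * (if s < p then 1 else 0) := by
      have h3 : ∑ s ∈ S, -tropicalOmega f s * (if s ≤ p then 1 else 0) =
          ∑ s ∈ S, -tropicalOmega f s * (if s < p then 1 else 0) +
            ∑ s ∈ S, if p = s then -tropicalOmega f s else 0 := by
        rw [← Finset.sum_add_distrib]
        refine Finset.sum_congr rfl fun s _ => ?_
        rcases lt_trichotomy s p with h | rfl | h
        · simp [h, h.le, h.ne']
        · simp
        · simp [h.not_ge, h.not_gt, h.ne]
      have h4 : (if p ∈ S then -tropicalOmega f p else 0) = -tropicalOmega f p := by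
        split_ifs with h
        · rfl
        · rw [hmem, not_and', not_not] at h
          rw [h (abs_le.2 ⟨hp.1.le, hp.2.le⟩), neg_zero]
      rw [h3, Finset.sum_ite_eq, h4, hab]; ring
    rw [h2] at h1
    exact ⟨_, h1⟩
  have hA := midpoint_le_of_slopes hG (x := -r) (y := r) (z := 0) (by linarith) hr fun p hp => by
    obtain ⟨a, ha⟩ := hGs p hp
    exact ⟨a, a, le_rfl, ha⟩
  have hB := midpoint_le_of_slopes hG.neg (x := -r) (y := r) (z := 0) (by linarith) hr
    fun p hp => by
      obtain ⟨a, ha⟩ := hGs p hp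
      exact ⟨-a, -a, le_rfl, ha.neg⟩
  have hC : 2 * G 0 = G (-r) + G r := by
    have h1 : r * (2 * G 0) ≤ r * (G (-r) + G r) := by linarith
    have h2 : r * (G (-r) + G r) ≤ r * (2 * G 0) := by
      simp only [Pi.neg_apply] at hB
      linarith
    exact mul_left_cancel₀ hr.ne' (le_antisymm h1 h2)
  -- For `|s| ≤ r` the hinge satisfies `(r - s)⁺ + (-r - s)⁺ - 2(-s)⁺ = r - |s|`.
  have hD : ∑ s ∈ S, -tropicalOmega f s * max (r - s) 0 +
      ∑ s ∈ S, -tropicalOmega f s * max (-r - s) 0 -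
      2 * ∑ s ∈ S, -tropicalOmega f s * max (0 - s) 0 =
      -∑ s ∈ S, tropicalOmega f s * (r - |s|) := by
    rw [Finset.mul_sum, ← Finset.sum_add_distrib, ← Finset.sum_sub_distrib,
      ← Finset.sum_neg_distrib]
    refine Finset.sum_congr rfl fun s hs => ?_
    have hs' := abs_le.1 ((hmem s).1 hs).2
    rw [max_eq_left (by linarith), max_eq_right (by linarith)]
    rcases le_total 0 s with h | h
    · rw [max_eq_right (by linarith), abs_of_nonneg h]; ring
    · rw [max_eq_left (by linarith), abs_of_nonpos h]; ring
  simp only [G] at hC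
  linarith

theorem IsTropicalEntire.convexOn {f : ℝ → ℝ} (hf : IsTropicalEntire f) :
    ConvexOn ℝ Set.univ f := by
  refine convexOn_of_slope_mono_adjacent convex_univ fun {x y z} _ _ hxy hyz => ?_
  have h := midpoint_le_of_slopes hf.1.1 hxy hyz fun p _ => by
    obtain ⟨a, b, h, hω⟩ := hf.1.exists_slopes p
    refine ⟨a, b, ?_, h⟩
    have := not_lt.1 (hf.2 p)
    linarith
  rw [div_le_div_iff₀ (by linarith) (by linarith)]
  linarith

/-! ### Borel type growth lemma. -/

/-- On a dyadic-type interval, the points at which a monotone function grows by `1` over a step of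
length `h` have small logarithmic measure. -/
theorem lintegral_inv_growth_le {φ : ℝ → ℝ} (hφ : Monotone φ) (hφ0 : ∀ x, 0 ≤ φ x) {a b h : ℝ}
    (ha : 0 < a) (hab : a ≤ b) (hh : 0 < h) {E : Set ℝ} (hEm : MeasurableSet E)
    (hE : ∀ r ∈ E, r ∈ Set.Ico a b ∧ φ r + 1 ≤ φ (r + h)) :
    ∫⁻ r in E, ENNReal.ofReal (1 / r) ≤ ENNReal.ofReal (h / a * φ (b + h)) := by
  have hint : IntervalIntegrable (fun r => slope φ r (r + h)) volume a b :=
    (hφ.monotoneOn _).intervalIntegrable_slope hab hh.le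
  have hnn : ∀ r, 0 ≤ h / a * slope φ r (r + h) := fun r => by
    have h1 : 0 ≤ φ (r + h) - φ r := sub_nonneg.2 (hφ (by linarith))
    simp only [slope, add_sub_cancel_left, vsub_eq_sub, smul_eq_mul]
    positivity
  -- On `E` the increment of `φ` is at least `1`, so `1/r ≤ (φ(r + h) - φ(r))/a`; the integral of
  -- the difference quotient telescopes and is at most `φ(b + h) - φ(a)`.
  calc ∫⁻ r in E, ENNReal.ofReal (1 / r)
      ≤ ∫⁻ r in E, ENNReal.ofReal (h / a * slope φ r (r + h)) := by
        refine setLIntegral_mono' hEm fun r hr => ENNReal.ofReal_le_ofReal ?_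
        obtain ⟨⟨h1, h2⟩, h3⟩ := hE r hr
        have h4 : h / a * slope φ r (r + h) = (φ (r + h) - φ r) / a := by
          simp only [slope, add_sub_cancel_left, vsub_eq_sub, smul_eq_mul]
          field_simp
        rw [h4]
        exact div_le_div₀ (by linarith) (by linarith) ha h1
    _ ≤ ∫⁻ r in Set.Ico a b, ENNReal.ofReal (h / a * slope φ r (r + h)) :=
        lintegral_mono_set fun r hr => (hE r hr).1
    _ = ∫⁻ r in Set.Ioc a b, ENNReal.ofReal (h / a * slope φ r (r + h)) :=
        setLIntegral_congr Ico_ae_eq_Ioc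
    _ = ENNReal.ofReal (∫ r in Set.Ioc a b, h / a * slope φ r (r + h)) := by
        rw [ofReal_integral_eq_lintegral_ofReal]
        · exact (hint.1).const_mul _
        · exact Eventually.of_forall hnn
    _ ≤ ENNReal.ofReal (h / a * φ (b + h)) := by
        refine ENNReal.ofReal_le_ofReal ?_
        rw [← intervalIntegral.integral_of_le hab, intervalIntegral.integral_const_mul]
        have h1 := (hφ.monotoneOn (Set.Icc a (b + h))).intervalIntegral_slope_le hab hh.le
        have h2 := hφ0 a
        gcongr
        linarith

/-- A Borel type growth lemma. -/
theorem hasFiniteLogMeasure_growth {φ : ℝ → ℝ} (hφ : Monotone φ) (hφ0 : ∀ x, 0 ≤ φ x)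
    (hφc : Continuous φ) {β δ : ℝ} (hβ : 0 ≤ β) (hδ : 0 < δ) (hβδ : β + δ < 1)
    (hgr : ∀ᶠ r in atTop, φ r ≤ r ^ β) :
    HasFiniteLogMeasure {r | 1 ≤ r ∧ φ r + 1 ≤ φ (r + r ^ δ)} := by
  set E : Set ℝ := {r | 1 ≤ r ∧ φ r + 1 ≤ φ (r + r ^ δ)} with hEdef
  have hrc : Continuous fun r : ℝ => r ^ δ := Real.continuous_rpow_const hδ.le
  have hEm : MeasurableSet E := by
    have h1 : IsClosed E :=
      (isClosed_le continuous_const continuous_id).inter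
        (isClosed_le (hφc.add continuous_const) (hφc.comp (continuous_id.add hrc)))
    exact h1.measurableSet
  refine ⟨fun r hr => hr.1, hEm, ?_⟩
  -- The step on the `k`-th dyadic block is frozen at its largest value; monotonicity of `φ`
  -- preserves the growth condition.
  let h : ℕ → ℝ := fun k => ((2 : ℝ) ^ (k + 1)) ^ δ
  let u : ℕ → ℝ := fun k => h k / 2 ^ k * φ (2 ^ (k + 1) + h k)
  have hhpos : ∀ k, 0 < h k := fun k => Real.rpow_pos_of_pos (by positivity) _
  have hu0 : ∀ k, 0 ≤ u k := fun k =>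
    mul_nonneg (div_nonneg (hhpos k).le (by positivity)) (hφ0 _)
  have hcov : E ⊆ ⋃ k : ℕ, E ∩ Set.Ico ((2 : ℝ) ^ k) (2 ^ (k + 1)) := by
    intro r hr
    obtain ⟨k, hk1, hk2⟩ := exists_nat_pow_near hr.1 (one_lt_two)
    exact Set.mem_iUnion.2 ⟨k, hr, hk1, hk2⟩
  have hpiece : ∀ k : ℕ, ∫⁻ r in E ∩ Set.Ico ((2 : ℝ) ^ k) (2 ^ (k + 1)), ENNReal.ofReal (1 / r) ≤
      ENNReal.ofReal (u k) := by
    intro k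
    refine lintegral_inv_growth_le hφ hφ0 (by positivity)
      (pow_le_pow_right₀ one_le_two (Nat.le_succ k)) (hhpos k) (hEm.inter measurableSet_Ico) ?_
    rintro r ⟨⟨h1, h2⟩, h3⟩
    refine ⟨h3, h2.trans (hφ ?_)⟩
    have : r ^ δ ≤ h k := Real.rpow_le_rpow (by linarith) h3.2.le hδ.le
    linarith
  have hsum : Summable u := by
    -- The argument `2^(k+1) + h k` is at most `2^(k+2)`, whence `u k ≤ 2^(δ(k+1) - k + β(k+2))` for
    -- large `k`. The ratio is below one exactly because `β + δ < 1`.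
    have hgeo : Summable fun k : ℕ => (2 : ℝ) ^ (δ + 2 * β) * ((2 : ℝ) ^ (δ + β - 1)) ^ k := by
      refine (summable_geometric_of_lt_one (by positivity) ?_).mul_left _
      exact Real.rpow_lt_one_of_one_lt_of_neg one_lt_two (by linarith)
    refine hgeo.of_norm_bounded_eventually_nat ?_
    have ht : Tendsto (fun k : ℕ => (2 : ℝ) ^ (k + 2)) atTop atTop :=
      (tendsto_pow_atTop_atTop_of_one_lt one_lt_two).comp (tendsto_add_atTop_nat 2)
    filter_upwards [ht.eventually hgr] with k hk
    rw [Real.norm_of_nonneg (hu0 k)]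
    have h1 : h k ≤ 2 ^ (k + 1) := by
      have h2 : h k ≤ ((2 : ℝ) ^ (k + 1)) ^ (1 : ℝ) :=
        Real.rpow_le_rpow_of_exponent_le (one_le_pow₀ one_le_two) (by linarith)
      rwa [Real.rpow_one] at h2
    have h2 : φ (2 ^ (k + 1) + h k) ≤ ((2 : ℝ) ^ (k + 2)) ^ β := by
      refine le_trans (hφ ?_) hk
      rw [pow_succ (2 : ℝ) (k + 1)]
      linarith
    calc u k ≤ h k / 2 ^ k * ((2 : ℝ) ^ (k + 2)) ^ β := by
          have := (hhpos k).le
          simp only [u]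
          gcongr
      _ = (2 : ℝ) ^ (δ + 2 * β) * ((2 : ℝ) ^ (δ + β - 1)) ^ k := by
          simp only [h]
          rw [← Real.rpow_natCast, ← Real.rpow_natCast, ← Real.rpow_natCast, ← Real.rpow_natCast,
            ← Real.rpow_mul zero_le_two, ← Real.rpow_mul zero_le_two, ← Real.rpow_mul zero_le_two,
            ← Real.rpow_sub two_pos, ← Real.rpow_add two_pos, ← Real.rpow_add two_pos]
          congr 1
          push_cast
          ring
  calc ∫⁻ r in E, ENNReal.ofReal (1 / r)
      ≤ ∫⁻ r in ⋃ k : ℕ, E ∩ Set.Ico ((2 : ℝ) ^ k) (2 ^ (k + 1)), ENNReal.ofReal (1 / r) :=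
        lintegral_mono_set hcov
    _ ≤ ∑' k : ℕ, ∫⁻ r in E ∩ Set.Ico ((2 : ℝ) ^ k) (2 ^ (k + 1)), ENNReal.ofReal (1 / r) :=
        lintegral_iUnion_le _ _
    _ ≤ ∑' k, ENNReal.ofReal (u k) := ENNReal.tsum_le_tsum hpiece
    _ < ⊤ := hsum.tsum_ofReal_lt_top

/-! ### Convex functions on the line and their increments. -/

namespace ConvexOn

variable {u : ℝ → ℝ}

theorem chord_le (hu : ConvexOn ℝ Set.univ u) {x y z : ℝ} (hxz : x ≤ z) (hzy : z ≤ y) :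
    (y - x) * u z ≤ (y - z) * u x + (z - x) * u y := by
  rcases (hxz.trans hzy).eq_or_lt with h | h
  · obtain rfl : x = z := by linarith
    obtain rfl : x = y := h
    simp
  · have hyx : 0 < y - x := by linarith
    have h1 := hu.2 (Set.mem_univ x) (Set.mem_univ y)
      (div_nonneg (by linarith) hyx.le : 0 ≤ (y - z) / (y - x))
      (div_nonneg (by linarith) hyx.le : 0 ≤ (z - x) / (y - x)) (by field_simp; ring)
    have h2 : ((y - z) / (y - x)) • x + ((z - x) / (y - x)) • y = z := by
      simp only [smul_eq_mul]; field_simp; ring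
    rw [h2] at h1
    calc (y - x) * u z ≤ (y - x) * (((y - z) / (y - x)) • u x + ((z - x) / (y - x)) • u y) :=
          mul_le_mul_of_nonneg_left h1 hyx.le
      _ = _ := by simp only [smul_eq_mul]; field_simp

theorem exists_affine_le (hu : ConvexOn ℝ Set.univ u) :
    ∃ A, 0 ≤ A ∧ ∀ x, -(A * (1 + |x|)) ≤ u x := by
  refine ⟨|u 0| + |u 1| + |u (-1)|, by positivity, fun x => ?_⟩
  have h0 := abs_le.1 (le_refl |u 0|)
  have h1 := abs_le.1 (le_refl |u 1|)
  have h2 := abs_le.1 (le_refl |u (-1)|)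
  rcases le_total 0 x with hx | hx
  · have := hu.chord_le (x := -1) (z := 0) (y := x) (by norm_num) hx
    rw [abs_of_nonneg hx]
    nlinarith [abs_nonneg (u 1), mul_nonneg hx (abs_nonneg (u 1)),
      mul_le_mul_of_nonneg_left h2.2 hx, mul_le_mul_of_nonneg_left h0.1 hx]
  · have := hu.chord_le (x := x) (z := 0) (y := 1) hx (by norm_num)
    rw [abs_of_nonpos hx]
    have hx' : 0 ≤ -x := by linarith
    nlinarith [abs_nonneg (u (-1)), mul_nonneg hx' (abs_nonneg (u (-1))),
      mul_le_mul_of_nonneg_left h1.2 hx', mul_le_mul_of_nonneg_left h0.1 hx']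

/-- If `u y > u x`, convexity makes `u` grow at least linearly along the ray from `x` through `y`.
-/
theorem eq_of_bddAbove (hu : ConvexOn ℝ Set.univ u) {M : ℝ} (hM : ∀ x, u x ≤ M) (x y : ℝ) :
    u x = u y := by
  have key : ∀ x y, u y ≤ u x := by
    intro x y
    by_contra! hlt
    obtain ⟨t, ht⟩ := exists_nat_gt ((M - u x) / (u y - u x))
    rw [div_lt_iff₀ (by linarith)] at ht
    have h0 : (0 : ℝ) < t + 1 := by positivity
    have h1 := hu.2 (Set.mem_univ x) (Set.mem_univ (x + (t + 1) * (y - x)))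
      (by positivity : (0 : ℝ) ≤ t / (t + 1)) (by positivity : (0 : ℝ) ≤ 1 / (t + 1))
      (by field_simp)
    have h2 : ((t : ℝ) / (t + 1)) • x + ((1 : ℝ) / (t + 1)) • (x + (t + 1) * (y - x)) = y := by
      simp only [smul_eq_mul]; field_simp; ring
    rw [h2, smul_eq_mul, smul_eq_mul] at h1
    have h3 : (t + 1) * u y ≤ t * u x + u (x + (t + 1) * (y - x)) := by
      calc (t + 1) * u y ≤ (t + 1) * (t / (t + 1) * u x +
            1 / (t + 1) * u (x + (t + 1) * (y - x))) := mul_le_mul_of_nonneg_left h1 h0.le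
        _ = _ := by field_simp
    have := hM (x + (t + 1) * (y - x))
    nlinarith
  exact le_antisymm (key y x) (key x y)

theorem comp_neg (hu : ConvexOn ℝ Set.univ u) : ConvexOn ℝ Set.univ (fun x => u (-x)) := by
  refine ⟨convex_univ, fun x _ y _ a b ha hb hab => ?_⟩
  have h := hu.2 (Set.mem_univ (-x)) (Set.mem_univ (-y)) ha hb hab
  have e : a • -x + b • -y = -(a • x + b • y) := by simp only [smul_eq_mul]; ring
  rwa [e] at h

/-- Differences of a convex function over a bounded step. -/
theorem sub_le_of_shift (hu : ConvexOn ℝ Set.univ u) {A : ℝ} (hA : 0 ≤ A)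
    (hlow : ∀ x, -(A * (1 + |x|)) ≤ u x) (hu0 : u 0 ≤ A) {r h s U : ℝ} (hr : 1 ≤ r) (hh : 0 < h)
    (hsr : |s| ≤ r) (hsh : |s| ≤ h) (hU : 0 ≤ U) (huU : u (r + h) ≤ U) :
    u (r + s) - u r ≤ |s| / h * (U + 2 * A * r) + 3 * A * |s| := by
  have hl := hlow r
  rw [abs_of_nonneg (by linarith : 0 ≤ r)] at hl
  have hAr : A ≤ A * r := le_mul_of_one_le_right hA hr
  -- A forward increment is bounded by the chord over `[r, r + h]`. For a backward one the chord
  -- over `[0, r]` suffices, since `u` can decrease at most linearly.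
  rcases le_total 0 s with hs | hs
  · rw [abs_of_nonneg hs] at *
    have h1 := hu.chord_le (x := r) (z := r + s) (y := r + h) (by linarith) (by linarith)
    have h2 : h * (u (r + s) - u r) ≤ s * (u (r + h) - u r) := by linarith
    have h3 : s * (u (r + h) - u r) ≤ s * (U + 2 * A * r) :=
      mul_le_mul_of_nonneg_left (by linarith) hs
    have h4 : u (r + s) - u r ≤ s / h * (U + 2 * A * r) := by
      rw [div_mul_eq_mul_div, le_div_iff₀ hh]; linarith
    have : 0 ≤ 3 * A * s := by positivity
    linarith
  · rw [abs_of_nonpos hs] at *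
    have h1 := hu.chord_le (x := 0) (z := r + s) (y := r) (by linarith) (by linarith)
    have h2 : r * (u (r + s) - u r) ≤ -s * (u 0 - u r) := by linarith
    have h3 : -s * (u 0 - u r) ≤ -s * (3 * A * r) :=
      mul_le_mul_of_nonneg_left (by linarith) (by linarith)
    have h4 : u (r + s) - u r ≤ 3 * A * -s := by
      have : r * (u (r + s) - u r) ≤ r * (3 * A * -s) := by linarith
      exact le_of_mul_le_mul_left this (by linarith)
    have : 0 ≤ -s / h * (U + 2 * A * r) := by
      have : 0 ≤ -s := by linarith
      positivity
    linarith

/-- If `u` is convex and dominated by `T`, and `T` grows at least linearly and at most by a bounded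
factor over steps of length `r ^ δ`, then bounded differences of `u` are `O(T / r ^ δ)`. -/
theorem exists_shift_le (hu : ConvexOn ℝ Set.univ u) {T : ℝ → ℝ} {l : Filter ℝ} (hl : l ≤ atTop)
    {δ κ B A₁ : ℝ} (hδ : 0 < δ) (hδ1 : δ ≤ 1) (hκ : 0 < κ) (hT : ∀ᶠ r in atTop, κ * r ≤ T r)
    (hA₁ : 0 ≤ A₁) (huT : ∀ᶠ r in atTop, u r ≤ A₁ * T r)
    (hgr : ∀ᶠ r in l, T (r + r ^ δ) ≤ B * T r) (s : ℝ) :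
    ∃ C, 0 ≤ C ∧ ∀ᶠ r in l, u (r + s) - u r ≤ C * (T r / r ^ δ) := by
  obtain ⟨A₀, hA₀, hlow₀⟩ := hu.exists_affine_le
  set A := A₀ + |u 0| with hAdef
  have hA : 0 ≤ A := by positivity
  have hlow : ∀ x, -(A * (1 + |x|)) ≤ u x := fun x => by
    have := hlow₀ x
    nlinarith [mul_nonneg (abs_nonneg (u 0)) (by positivity : 0 ≤ 1 + |x|)]
  have hu0 : u 0 ≤ A := by have := le_abs_self (u 0); linarith
  have hpow : Tendsto (fun r : ℝ => r ^ δ) atTop atTop := tendsto_rpow_atTop hδ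
  have hshift : Tendsto (fun r : ℝ => r + r ^ δ) atTop atTop := tendsto_id.atTop_add_atTop hpow
  -- The first two terms bound `u(r + r ^ δ) - u(r)` by means of `r ≤ T r / κ`; the last absorbs a
  -- constant, since `r ^ δ ≤ r ≤ T r / κ`.
  refine ⟨|s| * (A₁ * |B| + 2 * A / κ) + 3 * A * |s| / κ, by positivity, ?_⟩
  filter_upwards [hgr, hl hT, hl (hshift.eventually huT), hl (hshift.eventually hT),
    hl (eventually_ge_atTop 1), hl (eventually_ge_atTop |s|),
    hl (hpow.eventually_ge_atTop |s|)] with r h1 h2 h3 h4 h5 h6 h7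
  have hr0 : 0 < r := by linarith
  have hh : 0 < r ^ δ := Real.rpow_pos_of_pos hr0 _
  have hTr : 0 ≤ T r := le_trans (by positivity) h2
  have hTR : 0 ≤ T (r + r ^ δ) := le_trans (by positivity) h4
  have hrT : r ≤ T r / κ := by rw [le_div_iff₀ hκ]; linarith
  have hrδ : r ^ δ ≤ r := by
    simpa using Real.rpow_le_rpow_of_exponent_le h5 hδ1
  have h8 := hu.sub_le_of_shift hA hlow hu0 h5 hh h6 h7 (U := A₁ * T (r + r ^ δ)) (by positivity) h3
  have h9 : A₁ * T (r + r ^ δ) + 2 * A * r ≤ (A₁ * |B| + 2 * A / κ) * T r := by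
    have h10 : T (r + r ^ δ) ≤ |B| * T r :=
      h1.trans (mul_le_mul_of_nonneg_right (le_abs_self B) hTr)
    calc A₁ * T (r + r ^ δ) + 2 * A * r ≤ A₁ * (|B| * T r) + 2 * A * (T r / κ) := by gcongr
      _ = _ := by ring
  have h11 : (1 : ℝ) ≤ T r / r ^ δ / κ := by
    rw [le_div_iff₀ hκ, le_div_iff₀ hh]
    nlinarith
  calc u (r + s) - u r ≤ |s| / r ^ δ * (A₁ * T (r + r ^ δ) + 2 * A * r) + 3 * A * |s| := h8
    _ ≤ |s| / r ^ δ * ((A₁ * |B| + 2 * A / κ) * T r) + 3 * A * |s| * (T r / r ^ δ / κ) := by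
        have h12 : 0 ≤ |s| / r ^ δ := by positivity
        exact add_le_add (mul_le_mul_of_nonneg_left h9 h12)
          (le_mul_of_one_le_right (by positivity) h11)
    _ = _ := by ring

end ConvexOn

theorem ConvexOn.finset_sup' {ι : Type*} {S : Finset ι} (hS : S.Nonempty) {F : ι → ℝ → ℝ}
    (h : ∀ i ∈ S, ConvexOn ℝ Set.univ (F i)) :
    ConvexOn ℝ Set.univ (fun x => S.sup' hS fun i => F i x) := by
  have := Finset.sup'_induction hS F (p := ConvexOn ℝ Set.univ)
    (fun _ h1 _ h2 => h1.sup h2) h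
  convert this using 1
  ext x
  rw [Finset.sup'_apply]

/-! ### The tropical span of the generators and the Cartan characteristic. -/

section

variable {n : ℕ} {g : Fin (n + 1) → ℝ → ℝ}

theorem le_componentMax (j : Fin (n + 1)) (x : ℝ) : g j x ≤ componentMax g x :=
  Finset.le_sup' (fun j => g j x) (Finset.mem_univ j)

theorem convexOn_componentMax (hg : ∀ j, IsTropicalEntire (g j)) :
    ConvexOn ℝ Set.univ (componentMax g) :=
  ConvexOn.finset_sup' Finset.univ_nonempty fun j _ => (hg j).convexOn

theorem continuous_componentMax (hg : ∀ j, IsTropicalEntire (g j)) :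
    Continuous (componentMax g) :=
  (IsTropicalMeromorphic.sup' Finset.univ_nonempty fun j _ => (hg j).1).1

theorem tropicalLinComb_coe {K : Finset (Fin (n + 1))} (hK : K.Nonempty) (b : Fin (n + 1) → ℝ)
    (x : ℝ) :
    tropicalLinComb K (fun k => ((b k : ℝ) : RMax)) g x =
      ((K.sup' hK fun k => b k + g k x : ℝ) : RMax) := by
  rw [Finset.coe_sup']
  rfl

/-- A real valued tropical linear combination is a maximum over the nonempty set of indices with
real coefficients. -/
theorem exists_real_representation {a : Fin (n + 1) → RMax} {f : ℝ → ℝ}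
    (hf : ∀ x, ((f x : ℝ) : RMax) = tropicalLinComb Finset.univ a g x) :
    ∃ (K : Finset (Fin (n + 1))) (hK : K.Nonempty) (b : Fin (n + 1) → ℝ),
      (∀ x, ((f x : ℝ) : RMax) = tropicalLinComb K (fun k => ((b k : ℝ) : RMax)) g x) ∧
      ∀ x, f x = K.sup' hK fun k => b k + g k x := by
  classical
  let K : Finset (Fin (n + 1)) := Finset.univ.filter fun k => a k ≠ ⊥
  -- The default `0` is harmless: indices with coefficient `⊥` are not in `K`.
  let b : Fin (n + 1) → ℝ := fun k => (a k).unbotD 0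
  have hb : ∀ k, a k ≠ ⊥ → ((b k : ℝ) : RMax) = a k := by
    intro k hk
    obtain ⟨y, hy⟩ := WithBot.ne_bot_iff_exists.1 hk
    simp [b, ← hy]
  have h1 : ∀ x, ((f x : ℝ) : RMax) = tropicalLinComb K (fun k => ((b k : ℝ) : RMax)) g x := by
    intro x
    rw [hf x]
    apply le_antisymm
    · refine Finset.sup_le fun k _ => ?_
      by_cases hk : a k = ⊥
      · simp [hk]
      · refine le_trans (le_of_eq ?_) (Finset.le_sup (f := fun k => ((b k : ℝ) : RMax) +
          ((g k x : ℝ) : RMax)) (Finset.mem_filter.2 ⟨Finset.mem_univ k, hk⟩))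
        simp only [hb k hk]
    · refine Finset.sup_le fun k hk => ?_
      simp only [hb k (Finset.mem_filter.1 hk).2]
      exact Finset.le_sup (f := fun k => a k + ((g k x : ℝ) : RMax)) (Finset.mem_univ k)
  have hK : K.Nonempty := by
    by_contra hK
    rw [Finset.not_nonempty_iff_eq_empty] at hK
    have := h1 0
    rw [hK] at this
    simp [tropicalLinComb] at this
  refine ⟨K, hK, b, h1, fun x => ?_⟩
  have := h1 x
  rw [tropicalLinComb_coe hK] at this
  exact_mod_cast this

section combination

variable {a : Fin (n + 1) → RMax} {f : ℝ → ℝ}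

theorem isTropicalMeromorphic_of_linComb (hg : ∀ j, IsTropicalEntire (g j))
    (hf : ∀ x, ((f x : ℝ) : RMax) = tropicalLinComb Finset.univ a g x) :
    IsTropicalMeromorphic f := by
  obtain ⟨K, hK, b, -, h⟩ := exists_real_representation hf
  rw [funext h]
  exact IsTropicalMeromorphic.sup' hK fun k _ => (IsTropicalMeromorphic.const (b k)).add (hg k).1

theorem convexOn_of_linComb (hg : ∀ j, IsTropicalEntire (g j))
    (hf : ∀ x, ((f x : ℝ) : RMax) = tropicalLinComb Finset.univ a g x) :
    ConvexOn ℝ Set.univ f := by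
  obtain ⟨K, hK, b, -, h⟩ := exists_real_representation hf
  rw [funext h]
  refine ConvexOn.finset_sup' hK fun k _ => ?_
  exact (convexOn_const (b k) convex_univ).add (hg k).convexOn

theorem exists_le_componentMax_of_linComb
    (hf : ∀ x, ((f x : ℝ) : RMax) = tropicalLinComb Finset.univ a g x) :
    ∃ M, 0 ≤ M ∧ ∀ x, f x ≤ componentMax g x + M := by
  obtain ⟨K, hK, b, -, h⟩ := exists_real_representation hf
  refine ⟨∑ k, |b k|, by positivity, fun x => ?_⟩
  rw [h]
  refine Finset.sup'_le _ _ fun k _ => ?_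
  have h1 := le_componentMax (g := g) k x
  have h2 := Finset.single_le_sum (f := fun k => |b k|) (fun k _ => abs_nonneg _)
    (Finset.mem_univ k)
  have h3 := le_abs_self (b k)
  linarith

/-- A complete element of the span dominates the maximum of the generators. -/
theorem exists_componentMax_le_of_complete
    (hf : ∀ x, ((f x : ℝ) : RMax) = tropicalLinComb Finset.univ a g x)
    (hc : ¬ tropicalShortestLength g f < n + 1) :
    ∃ M, 0 ≤ M ∧ ∀ x, componentMax g x ≤ f x + M := by
  obtain ⟨K, hK, b, hrep, h⟩ := exists_real_representation hf
  -- Minimality of `ℓ` makes any representation of a complete element use all `n + 1` generators.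
  have hlen : tropicalShortestLength g f ≤ K.card := Nat.sInf_le ⟨K, b, rfl, hrep⟩
  have hKu : K = Finset.univ := by
    rw [← Finset.card_eq_iff_eq_univ, Fintype.card_fin]
    have := K.card_le_univ
    rw [Fintype.card_fin] at this
    omega
  subst hKu
  refine ⟨∑ k, |b k|, by positivity, fun x => ?_⟩
  rw [h]
  refine Finset.sup'_le _ _ fun k _ => ?_
  have h1 := Finset.le_sup' (fun k => b k + g k x) (Finset.mem_univ k)
  have h2 := Finset.single_le_sum (f := fun k => |b k|) (fun k _ => abs_nonneg _)
    (Finset.mem_univ k)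
  have h3 := neg_abs_le (b k)
  linarith

end combination

theorem cartanCharacteristic_zero : cartanCharacteristic g 0 = 0 := by
  simp [cartanCharacteristic]
  ring

theorem continuous_cartanCharacteristic (hg : ∀ j, IsTropicalEntire (g j)) :
    Continuous (cartanCharacteristic g) := by
  have := continuous_componentMax hg
  unfold cartanCharacteristic
  fun_prop

theorem convexOn_cartanCharacteristic (hg : ∀ j, IsTropicalEntire (g j)) :
    ConvexOn ℝ Set.univ (cartanCharacteristic g) := by
  have h := convexOn_componentMax hg
  have h1 := ((h.add h.comp_neg).smul (by norm_num : (0 : ℝ) ≤ 1 / 2)).add_const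
    (-componentMax g 0)
  have e : cartanCharacteristic g = (fun x => (1 / 2 : ℝ) • (componentMax g +
      fun x => componentMax g (-x)) x) + fun _ => -componentMax g 0 := by
    ext x
    simp [cartanCharacteristic, sub_eq_add_neg]
  rw [e]
  exact h1

theorem cartanCharacteristic_nonneg (hg : ∀ j, IsTropicalEntire (g j)) (r : ℝ) :
    0 ≤ cartanCharacteristic g r := by
  have h := convexOn_componentMax hg
  unfold cartanCharacteristic
  have key : ∀ t : ℝ, 0 ≤ t → 2 * componentMax g 0 ≤ componentMax g t + componentMax g (-t) := by
    intro t ht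
    rcases ht.eq_or_lt with rfl | ht
    · rw [neg_zero]; linarith
    · have := h.chord_le (x := -t) (z := 0) (y := t) (by linarith) ht.le
      have h2 : t * (2 * componentMax g 0) ≤ t * (componentMax g t + componentMax g (-t)) := by
        linarith
      exact le_of_mul_le_mul_left h2 ht
  rcases le_total 0 r with hr | hr
  · have := key r hr; linarith
  · have := key (-r) (by linarith)
    rw [neg_neg] at this
    linarith

/-- Convexity together with `T_g(0) = 0` makes `T_g(r)/r` nondecreasing. -/
theorem mul_cartanCharacteristic_le (hg : ∀ j, IsTropicalEntire (g j)) {x y : ℝ} (hx : 0 ≤ x)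
    (hxy : x ≤ y) : y * cartanCharacteristic g x ≤ x * cartanCharacteristic g y := by
  have := (convexOn_cartanCharacteristic hg).chord_le hx hxy
  rw [cartanCharacteristic_zero] at this
  linarith

theorem monotoneOn_cartanCharacteristic (hg : ∀ j, IsTropicalEntire (g j)) :
    MonotoneOn (cartanCharacteristic g) (Set.Ici 0) := by
  intro x hx y hy hxy
  have hx : 0 ≤ x := hx
  rcases hx.eq_or_lt with rfl | hx
  · rw [cartanCharacteristic_zero]; exact cartanCharacteristic_nonneg hg y
  · have h1 := mul_cartanCharacteristic_le hg hx.le hxy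
    have h2 := mul_le_mul_of_nonneg_right hxy (cartanCharacteristic_nonneg hg y)
    exact le_of_mul_le_mul_left (h1.trans h2) (hx.trans_le hxy)

/-- If the characteristic vanishes identically, then the generators differ by constants. -/
theorem exists_const_of_cartanCharacteristic_eq_zero (hg : ∀ j, IsTropicalEntire (g j))
    (h0 : ∀ r, 0 ≤ r → cartanCharacteristic g r = 0) (j : Fin (n + 1)) :
    ∃ k, ∀ x, componentMax g x = g j x + k := by
  have hF := convexOn_componentMax hg
  have hsymm : ∀ x, componentMax g x + componentMax g (-x) = 2 * componentMax g 0 := by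
    intro x
    rcases le_total 0 x with hx | hx
    · have := h0 x hx
      unfold cartanCharacteristic at this
      linarith
    · have := h0 (-x) (by linarith)
      unfold cartanCharacteristic at this
      rw [neg_neg] at this
      linarith
  -- Since `F(-x) = 2F(0) - F(x)`, this convex function is `g_j - F` up to a constant. It is bounded
  -- above, hence constant.
  have hconv : ConvexOn ℝ Set.univ fun x => g j x + componentMax g (-x) :=
    (hg j).convexOn.add hF.comp_neg
  refine ⟨2 * componentMax g 0 - (g j 0 + componentMax g (-0)), fun x => ?_⟩
  have := hconv.eq_of_bddAbove (M := 2 * componentMax g 0) (fun y => by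
    have h1 := hsymm y
    have h2 := le_componentMax (g := g) j y
    linarith) x 0
  have h1 := hsymm x
  linarith

/-- With the coefficients `k_j` every term equals `F`, so any split into two nonempty index sets is
a relation; `n ≥ 1` provides one. -/
theorem gondranMinouxDependent_of_const (hn : 1 ≤ n)
    (h : ∀ j, ∃ k, ∀ x, componentMax g x = g j x + k) : GondranMinouxDependent g := by
  classical
  choose k hk using h
  have hval : ∀ (K : Finset (Fin (n + 1))), K.Nonempty → ∀ x,
      tropicalLinComb K (fun j => ((k j : ℝ) : RMax)) g x = ((componentMax g x : ℝ) : RMax) := by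
    intro K hK x
    rw [tropicalLinComb_coe hK]
    congr 1
    have : (fun j => k j + g j x) = fun _ => componentMax g x := by
      funext j
      rw [hk j x, add_comm]
    rw [this, Finset.sup'_const]
  have hne : (⟨1, by omega⟩ : Fin (n + 1)) ≠ 0 := by
    intro h
    simpa using congrArg Fin.val h
  refine ⟨{0}, {0}ᶜ, disjoint_compl_right, by simp, fun j => ((k j : ℝ) : RMax),
    ⟨0, WithBot.coe_ne_bot⟩, fun x => ?_⟩
  rw [hval _ (by simp), hval _ ⟨⟨1, by omega⟩, by simp⟩]

/-- Independence excludes `T_g ≡ 0`, and from a point where `T_g > 0` the monotone quotient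
`T_g(r)/r` stays bounded below. -/
theorem exists_linear_le_cartanCharacteristic (hn : 1 ≤ n) (hg : ∀ j, IsTropicalEntire (g j))
    (hind : GondranMinouxIndependent g) :
    ∃ κ, 0 < κ ∧ ∀ᶠ r in atTop, κ * r ≤ cartanCharacteristic g r := by
  have h1 : ∃ r, 0 ≤ r ∧ cartanCharacteristic g r ≠ 0 := by
    by_contra! h0
    exact hind (gondranMinouxDependent_of_const hn
      (exists_const_of_cartanCharacteristic_eq_zero hg h0))
  obtain ⟨r₁, hr₁, hT⟩ := h1
  have hr₁' : 0 < r₁ := by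
    refine lt_of_le_of_ne hr₁ ?_
    rintro rfl
    exact hT cartanCharacteristic_zero
  have hT' : 0 < cartanCharacteristic g r₁ :=
    lt_of_le_of_ne (cartanCharacteristic_nonneg hg r₁) hT.symm
  refine ⟨cartanCharacteristic g r₁ / r₁, by positivity, ?_⟩
  filter_upwards [eventually_ge_atTop r₁] with r hr
  rw [div_mul_eq_mul_div, div_le_iff₀ hr₁']
  have := mul_cartanCharacteristic_le hg hr₁ hr
  linarith

/-- A function dominated by `F` is dominated by a multiple of the characteristic. -/
theorem exists_le_mul_cartanCharacteristic (hg : ∀ j, IsTropicalEntire (g j)) {κ M : ℝ}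
    (hκ : 0 < κ) (hM : 0 ≤ M) (hT : ∀ᶠ r in atTop, κ * r ≤ cartanCharacteristic g r) :
    ∃ A, 0 ≤ A ∧ ∀ᶠ r in atTop, componentMax g r + M ≤ A * cartanCharacteristic g r ∧
      componentMax g (-r) + M ≤ A * cartanCharacteristic g r := by
  obtain ⟨B, hB, hlow⟩ := (convexOn_componentMax hg).exists_affine_le
  -- One has `F(r) = 2T_g(r) + 2F(0) - F(-r)`, and `-F(-r)` grows at most linearly, hence is
  -- absorbed by `r ≤ T_g(r)/κ`; the same with `r` and `-r` exchanged.
  refine ⟨2 + (2 * |componentMax g 0| + 2 * B + M) / κ, by positivity, ?_⟩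
  filter_upwards [hT, eventually_ge_atTop 1] with r h1 h2
  have h3 := hlow r
  have h4 := hlow (-r)
  rw [abs_neg, abs_of_nonneg (by linarith)] at h4
  rw [abs_of_nonneg (by linarith)] at h3
  have h5 : componentMax g r + componentMax g (-r) =
      2 * cartanCharacteristic g r + 2 * componentMax g 0 := by
    unfold cartanCharacteristic; ring
  have h6 : r ≤ cartanCharacteristic g r / κ := by rw [le_div_iff₀ hκ]; linarith
  have h7 := le_abs_self (componentMax g 0)
  have h8 : 2 * |componentMax g 0| + B * (1 + r) + M ≤
      (2 * |componentMax g 0| + 2 * B + M) / κ * cartanCharacteristic g r := by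
    calc 2 * |componentMax g 0| + B * (1 + r) + M
        ≤ (2 * |componentMax g 0| + 2 * B + M) * r := by
          nlinarith [mul_nonneg hB (by linarith : 0 ≤ r - 1),
            mul_nonneg hM (by linarith : 0 ≤ r - 1),
            mul_nonneg (abs_nonneg (componentMax g 0)) (by linarith : 0 ≤ r - 1)]
      _ ≤ (2 * |componentMax g 0| + 2 * B + M) * (cartanCharacteristic g r / κ) := by gcongr
      _ = _ := by ring
  constructor <;> linarith

theorem log_cartanCharacteristic_le {κ ς β : ℝ} (hκ : 0 < κ)
    (hT : ∀ᶠ r in atTop, κ * r ≤ cartanCharacteristic g r)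
    (hς : cartanHyperOrder g = (ς : EReal)) (hβ : ς < β) :
    ∀ᶠ r in atTop, 1 < Real.log (cartanCharacteristic g r) ∧
      Real.log (cartanCharacteristic g r) ≤ r ^ β := by
  have h1 : cartanHyperOrder g < (β : EReal) := by rw [hς]; exact_mod_cast hβ
  have hTt : Tendsto (cartanCharacteristic g) atTop atTop :=
    tendsto_atTop_mono' _ hT (tendsto_id.const_mul_atTop hκ)
  filter_upwards [eventually_lt_of_limsup_lt h1,
    (Real.tendsto_log_atTop.comp hTt).eventually_gt_atTop 1, eventually_gt_atTop 1]
    with r h2 h3 h4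
  refine ⟨h3, ?_⟩
  have h5 : Real.log (Real.log (cartanCharacteristic g r)) / Real.log r < β := by
    exact_mod_cast h2
  rw [div_lt_iff₀ (Real.log_pos h4)] at h5
  have h3' : 0 < Real.log (cartanCharacteristic g r) := lt_trans one_pos h3
  rw [Real.rpow_def_of_pos (by linarith), ← Real.log_le_iff_le_exp h3']
  linarith

/-- Outside a set of finite logarithmic measure the characteristic grows at most by a bounded factor
over steps of length `r ^ δ`. -/
theorem exists_exceptional_set (hg : ∀ j, IsTropicalEntire (g j)) {κ ς β δ : ℝ} (hκ : 0 < κ)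
    (hT : ∀ᶠ r in atTop, κ * r ≤ cartanCharacteristic g r)
    (hς : cartanHyperOrder g = (ς : EReal)) (hβ : ς < β) (hβ0 : 0 ≤ β) (hδ : 0 < δ)
    (hβδ : β + δ < 1) :
    ∃ E : Set ℝ, HasFiniteLogMeasure E ∧ ∀ᶠ r in atTop ⊓ 𝓟 Eᶜ,
      cartanCharacteristic g (r + r ^ δ) ≤ Real.exp 1 * cartanCharacteristic g r := by
  -- This is `log T_g`, truncated so as to be monotone and nonnegative on all of `ℝ`; the
  -- truncations are inactive for large `r`.
  let φ : ℝ → ℝ := fun r => Real.log (max 1 (cartanCharacteristic g (max r 0)))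
  have hφ : Monotone φ := fun x y hxy => by
    have h1 : cartanCharacteristic g (max x 0) ≤ cartanCharacteristic g (max y 0) :=
      monotoneOn_cartanCharacteristic hg (le_max_right x 0) (le_max_right y 0)
        (max_le_max_right 0 hxy)
    exact Real.log_le_log (by positivity) (max_le_max_left 1 h1)
  have hφ0 : ∀ x, 0 ≤ φ x := fun x => Real.log_nonneg (le_max_left _ _)
  have hφc : Continuous φ := by
    have h1 := continuous_cartanCharacteristic hg
    refine Continuous.log (by fun_prop) fun x => ?_
    positivity
  have hlog := log_cartanCharacteristic_le hκ hT hς hβ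
  have hφT : ∀ r, 0 ≤ r → 1 ≤ cartanCharacteristic g r →
      φ r = Real.log (cartanCharacteristic g r) := fun r h1 h2 => by
    simp only [φ, max_eq_left h1, max_eq_right h2]
  have hTt : Tendsto (cartanCharacteristic g) atTop atTop :=
    tendsto_atTop_mono' _ hT (tendsto_id.const_mul_atTop hκ)
  refine ⟨_, hasFiniteLogMeasure_growth hφ hφ0 hφc hβ0 hδ hβδ ?_, ?_⟩
  · filter_upwards [hlog, eventually_ge_atTop 0, hTt.eventually_ge_atTop 1] with r h1 h2 h3
    rw [hφT r h2 h3]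
    exact h1.2
  · rw [eventually_inf_principal]
    filter_upwards [eventually_ge_atTop 1, hTt.eventually_ge_atTop 1] with r h1 h2 h3
    have h4 : φ (r + r ^ δ) < φ r + 1 := by
      by_contra! h
      exact h3 ⟨h1, h⟩
    have hpow : 0 ≤ r ^ δ := Real.rpow_nonneg (by linarith) _
    have h5 : cartanCharacteristic g r ≤ cartanCharacteristic g (r + r ^ δ) :=
      monotoneOn_cartanCharacteristic hg (show 0 ≤ r by linarith)
        (show 0 ≤ r + r ^ δ by linarith) (by linarith)
    have h6 : 1 ≤ cartanCharacteristic g (r + r ^ δ) := h2.trans h5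
    rw [hφT r (by linarith) h2, hφT _ (by linarith) h6] at h4
    rw [Real.log_lt_iff_lt_exp (by linarith), Real.exp_add, Real.exp_log (by linarith)] at h4
    linarith

end

/-! ### The Casoratian and the main inequality. -/

/-- Each permutation's sum is compared termwise with the unshifted sum; summing `C i k` over all `k`
makes the bound independent of the permutation. -/
theorem tropicalCasoratian_le {n : ℕ} {c : ℝ} {f : Fin (n + 1) → ℝ → ℝ} {x D : ℝ}
    {C : Fin (n + 1) → Fin (n + 1) → ℝ} (hC : ∀ i k, 0 ≤ C i k)
    (h : ∀ i (k : Fin (n + 1)), f i (x + ((k : ℕ) : ℝ) * c) - f i x ≤ C i k * D) (hD : 0 ≤ D) :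
    tropicalCasoratian c f x ≤ ∑ i, f i x + (∑ i, ∑ k, C i k) * D := by
  refine Finset.sup'_le _ _ fun π _ => ?_
  rw [Finset.sum_mul, ← Finset.sum_add_distrib]
  refine Finset.sum_le_sum fun i _ => ?_
  have h1 := h i (π i)
  have h2 := Finset.single_le_sum (f := fun k => C i k) (fun k _ => hC i k)
    (Finset.mem_univ (π i))
  have h3 := mul_le_mul_of_nonneg_right h2 hD
  linarith

theorem sum_split_castLE {n q : ℕ} (hnq : n < q) (F : Fin (q + 1) → ℝ) :
    ∑ k, F k = ∑ i : Fin (n + 1), F (Fin.castLE (Nat.succ_le_succ hnq.le) i) +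
      ∑ ν : {k : Fin (q + 1) // n < (k : ℕ)}, F ν := by
  classical
  rw [← Fintype.sum_subtype_add_sum_subtype (fun k : Fin (q + 1) => n < (k : ℕ)) F, add_comm]
  congr 1
  refine (Fintype.sum_bijective (fun i : Fin (n + 1) =>
    (⟨Fin.castLE (Nat.succ_le_succ hnq.le) i, by simp; omega⟩ :
      {k : Fin (q + 1) // ¬ n < (k : ℕ)})) ⟨?_, ?_⟩ _ _ fun _ => rfl).symm
  · intro i j h
    simpa [Fin.ext_iff] using h
  · rintro ⟨k, hk⟩
    exact ⟨⟨k, by omega⟩, rfl⟩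

theorem isTropicalMeromorphic_cartanQuotient {n q : ℕ} (hnq : n < q) (c : ℝ)
    {f : Fin (q + 1) → ℝ → ℝ} (hf : ∀ k, IsTropicalMeromorphic (f k)) :
    IsTropicalMeromorphic (cartanQuotient hnq c f) := by
  refine (IsTropicalMeromorphic.sum _ fun k _ => hf k).sub
    (IsTropicalMeromorphic.sup' Finset.univ_nonempty fun π _ => ?_)
  exact IsTropicalMeromorphic.sum _ fun i _ => (hf _).comp_add_const _

/-- The complete members contribute the characteristic, the others at least a constant. -/
theorem exists_le_sum_of_degreeOfDegeneracy {n q : ℕ} (hnq : n < q) {g : Fin (n + 1) → ℝ → ℝ}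
    (hg : ∀ j, IsTropicalEntire (g j)) {a : Fin (n + 1) → Fin (q + 1) → RMax}
    {f : Fin (q + 1) → ℝ → ℝ}
    (hf : ∀ k x, ((f k x : ℝ) : RMax) = tropicalLinComb Finset.univ (fun j => a j k) g x) :
    ∃ M, ∀ r, ((q : ℝ) - n - degreeOfDegeneracy g
        (fun ν : {k : Fin (q + 1) // n < (k : ℕ)} => f ν)) * cartanCharacteristic g r - M ≤
      (1 / 2) * (∑ ν : {k : Fin (q + 1) // n < (k : ℕ)}, f ν r +
        ∑ ν : {k : Fin (q + 1) // n < (k : ℕ)}, f ν (-r)) := by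
  classical
  have hconv : ∀ (k : Fin (q + 1)) r, 2 * f k 0 ≤ f k r + f k (-r) := by
    intro k r
    have h := (convexOn_of_linComb hg (hf k)).2 (Set.mem_univ r) (Set.mem_univ (-r))
      (by norm_num : (0 : ℝ) ≤ 1 / 2) (by norm_num : (0 : ℝ) ≤ 1 / 2) (by norm_num)
    have e : (1 / 2 : ℝ) • r + (1 / 2 : ℝ) • -r = 0 := by simp
    rw [e, smul_eq_mul, smul_eq_mul] at h
    linarith
  have hν : ∀ ν : {k : Fin (q + 1) // n < (k : ℕ)}, ∃ M, ∀ r,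
      cartanCharacteristic g r - (if tropicalShortestLength g (f ν) < n + 1 then
        cartanCharacteristic g r else 0) - M ≤ (1 / 2) * (f ν r + f ν (-r)) := by
    intro ν
    split_ifs with hc
    · refine ⟨-f ν 0, fun r => ?_⟩
      have := hconv ν r
      linarith
    · obtain ⟨M, -, hM⟩ := exists_componentMax_le_of_complete (hf ν) hc
      refine ⟨M - componentMax g 0, fun r => ?_⟩
      have h1 := hM r
      have h2 := hM (-r)
      unfold cartanCharacteristic
      linarith
  choose M hM using hν
  refine ⟨∑ ν, M ν, fun r => ?_⟩
  have h1 := Finset.sum_le_sum fun (ν : {k : Fin (q + 1) // n < (k : ℕ)})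
    (_ : ν ∈ Finset.univ) => hM ν r
  rw [← Finset.mul_sum, Finset.sum_add_distrib, Finset.sum_sub_distrib,
    Finset.sum_sub_distrib, ← Finset.sum_filter, Finset.sum_const, Finset.sum_const,
    nsmul_eq_mul, nsmul_eq_mul] at h1
  have h2 : degreeOfDegeneracy g (fun ν : {k : Fin (q + 1) // n < (k : ℕ)} => f ν) =
      (Finset.univ.filter fun ν : {k : Fin (q + 1) // n < (k : ℕ)} =>
        tropicalShortestLength g (f ν) < n + 1).card := by
    unfold degreeOfDegeneracy
    rw [Set.ncard_eq_toFinset_card', Set.toFinset_ofPred]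
  -- Splitting the constant sum `1` shows that there are `q - n` indices beyond `n`.
  have h3 := sum_split_castLE hnq fun _ => 1
  simp only [Finset.sum_const, nsmul_eq_mul, mul_one, Finset.card_univ, Fintype.card_fin] at h3
  push_cast at h3
  rw [h2]
  refine le_trans (le_of_eq ?_) h1
  rw [Finset.card_univ]
  linear_combination (-cartanCharacteristic g r) * (-h3)

theorem isLittleO_div_rpow {T : ℝ → ℝ} {p p₀ : ℝ} (hp : p₀ < p) (B : ℝ) :
    (fun r => B * (T r / r ^ p)) =o[atTop] fun r => T r / r ^ p₀ := by
  have h1 : (fun r : ℝ => (r ^ p)⁻¹) =o[atTop] fun r : ℝ => (r ^ p₀)⁻¹ := by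
    refine IsLittleO.of_tendsto_div_atTop ?_
    refine (tendsto_rpow_atTop (sub_pos.2 hp)).congr' ?_
    filter_upwards [eventually_gt_atTop 0] with r hr
    rw [Real.rpow_sub hr, inv_div_inv]
  simp only [div_eq_mul_inv]
  exact ((isBigO_refl T atTop).mul_isLittleO h1).const_mul_left B

theorem theorem6p2 (n q : ℕ) (hn : 1 ≤ n) (hnq : n < q)
    (ε : ℝ) (hε : 0 < ε) (c : ℝ) (hc : c ≠ 0)
    (g : Fin (n + 1) → ℝ → ℝ) (hg : IsReducedRepresentation g)
    (hind : GondranMinouxIndependent g)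
    (a : Fin (n + 1) → Fin (q + 1) → RMax) (f : Fin (q + 1) → ℝ → ℝ)
    (hf : ∀ k x, ((f k x : ℝ) : RMax) = tropicalLinComb Finset.univ (fun j => a j k) g x)
    (lam : ℕ)
    (hlam : lam = degreeOfDegeneracy g (fun ν : {k : Fin (q + 1) // n < (k : ℕ)} => f ν))
    (ς : ℝ) (hς : cartanHyperOrder g = (ς : EReal)) (hς1 : ς < 1) :
    ∃ E : Set ℝ, HasFiniteLogMeasure E ∧ ∃ R : ℝ → ℝ,
      R =o[atTop ⊓ 𝓟 Eᶜ] (fun r : ℝ => cartanCharacteristic g r / r ^ (1 - ς - ε)) ∧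
      ∀ᶠ r in atTop ⊓ 𝓟 Eᶜ,
        ((q : ℝ) - n - lam) * cartanCharacteristic g r ≤
          tropicalCounting (fun x => 0 - cartanQuotient hnq c f x) r
            - tropicalCounting (cartanQuotient hnq c f) r + R r := by
  have hg' := hg.1
  obtain ⟨κ, hκ, hT⟩ := exists_linear_le_cartanCharacteristic hn hg' hind
  -- With `β = ς + e/2` and `δ = 1 - ς - e` one gets `β + δ = 1 - e/2 < 1`. The bound `e < 1 - ς`
  -- keeps `δ > 0`, and `e < ε` makes `T_g / r ^ δ` negligible against the stated error.
  obtain ⟨e, he, heε, heς⟩ : ∃ e, 0 < e ∧ e < ε ∧ e < 1 - ς := by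
    obtain ⟨e, he1, he2⟩ := exists_between (lt_min hε (sub_pos.2 hς1))
    exact ⟨e, he1, he2.trans_le (min_le_left _ _), he2.trans_le (min_le_right _ _)⟩
  set β := ς + e / 2 with hβdef
  set δ := 1 - ς - e with hδdef
  have hβ : ς < β := by linarith
  have hδ : 0 < δ := by linarith
  have hβδ : β + δ < 1 := by linarith
  have hβ0 : 0 ≤ β := by
    -- A negative `β` would give `r ^ β ≤ 1`, whereas `1 < log T_g(r) ≤ r ^ β` for large `r`.
    by_contra! hneg
    obtain ⟨r, ⟨h1, h2⟩, h3⟩ :=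
      ((log_cartanCharacteristic_le hκ hT hς hβ).and (eventually_ge_atTop 1)).exists
    have := Real.rpow_le_one_of_one_le_of_nonpos h3 hneg.le
    linarith
  have hδ1 : δ ≤ 1 := by linarith
  obtain ⟨E, hE, hgrowth⟩ := exists_exceptional_set hg' hκ hT hς hβ hβ0 hδ hβδ
  set T := cartanCharacteristic g with hTdef
  set l : Filter ℝ := atTop ⊓ 𝓟 Eᶜ with hldef
  have hl : l ≤ atTop := inf_le_left
  let f' : Fin (n + 1) → ℝ → ℝ := fun i => f (Fin.castLE (Nat.succ_le_succ hnq.le) i)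
  have hdiff : ∀ i k : Fin (n + 1), ∃ C, 0 ≤ C ∧ ∀ᶠ r in l,
      f' i (r + ((k : ℕ) : ℝ) * c) - f' i r ≤ C * (T r / r ^ δ) := by
    intro i k
    obtain ⟨M, hM, hle⟩ := exists_le_componentMax_of_linComb
      (hf (Fin.castLE (Nat.succ_le_succ hnq.le) i))
    obtain ⟨A, hA, hAle⟩ := exists_le_mul_cartanCharacteristic hg' hκ hM hT
    exact (convexOn_of_linComb hg' (hf _)).exists_shift_le hl hδ hδ1 hκ hT hA
      (hAle.mono fun r h => (hle r).trans h.1) hgrowth _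
  have hdiff' : ∀ i k : Fin (n + 1), ∃ C, 0 ≤ C ∧ ∀ᶠ r in l,
      f' i (-r + ((k : ℕ) : ℝ) * c) - f' i (-r) ≤ C * (T r / r ^ δ) := by
    intro i k
    obtain ⟨M, hM, hle⟩ := exists_le_componentMax_of_linComb
      (hf (Fin.castLE (Nat.succ_le_succ hnq.le) i))
    obtain ⟨A, hA, hAle⟩ := exists_le_mul_cartanCharacteristic hg' hκ hM hT
    -- Behaviour at `-r` is that of the reflected convex function at `r`, with the shift reversed.
    obtain ⟨C, hC, h⟩ := (convexOn_of_linComb hg' (hf _)).comp_neg.exists_shift_le hl hδ hδ1 hκ hT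
      hA (hAle.mono fun r h => (hle (-r)).trans h.2) hgrowth (-(((k : ℕ) : ℝ) * c))
    refine ⟨C, hC, h.mono fun r hr => ?_⟩
    rwa [neg_add, neg_neg] at hr
  choose C hC hCle using hdiff
  choose C' hC' hCle' using hdiff'
  obtain ⟨M, hM⟩ := exists_le_sum_of_degreeOfDegeneracy hnq hg' hf
  set L := cartanQuotient hnq c f with hL
  -- The halves come from Jensen's mean over `±r`; the last term absorbs the constant `M + L 0`, as
  -- `κ ≤ T r / r ^ δ`.
  set B : ℝ := (1 / 2) * ((∑ i, ∑ k, C i k) + ∑ i, ∑ k, C' i k) + |M + L 0| / κ with hB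
  refine ⟨E, hE, fun r => B * (T r / r ^ δ),
    (isLittleO_div_rpow (by linarith) B).mono hl, ?_⟩
  filter_upwards [eventually_all.2 fun i => eventually_all.2 fun k => hCle i k,
    eventually_all.2 fun i => eventually_all.2 fun k => hCle' i k,
    hl hT, hl (eventually_ge_atTop 1)] with r h1 h2 h3 h4
  have hr : 0 < r := by linarith
  have hpow : 0 < r ^ δ := Real.rpow_pos_of_pos hr _
  have hpowr : r ^ δ ≤ r := by
    simpa using Real.rpow_le_rpow_of_exponent_le h4 hδ1
  have hD : 0 ≤ T r / r ^ δ := div_nonneg (cartanCharacteristic_nonneg hg' r) hpow.le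
  rw [tropical_jensen (isTropicalMeromorphic_cartanQuotient hnq c fun k =>
    isTropicalMeromorphic_of_linComb hg' (hf k)) hr, hlam]
  have h5 := tropicalCasoratian_le hC h1 hD
  have h6 := tropicalCasoratian_le hC' h2 hD
  have h7 : L r = ∑ i, f' i r + ∑ ν : {k : Fin (q + 1) // n < (k : ℕ)}, f ν r -
      tropicalCasoratian c f' r := by
    rw [hL, cartanQuotient, sum_split_castLE hnq]
  have h8 : L (-r) = ∑ i, f' i (-r) + ∑ ν : {k : Fin (q + 1) // n < (k : ℕ)}, f ν (-r) -
      tropicalCasoratian c f' (-r) := by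
    rw [hL, cartanQuotient, sum_split_castLE hnq]
  have h9 := hM r
  have h10 : M + L 0 ≤ |M + L 0| / κ * (T r / r ^ δ) := by
    have h11 : κ ≤ T r / r ^ δ := by
      rw [le_div_iff₀ hpow]
      exact (mul_le_mul_of_nonneg_left hpowr hκ.le).trans h3
    calc M + L 0 ≤ |M + L 0| / κ * κ := by
          rw [div_mul_cancel₀ _ hκ.ne']; exact le_abs_self _
      _ ≤ _ := by gcongr
  rw [← hL, h7, h8, hB]
  linarith
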